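/- Let $\Omega\subset\mathbb{R}^2$ be a bounded open set with $C^1$ boundary, with outward unit normal $\mathbf n=[n_x,n_y]^T$ on $\partial\Omega$, let $g>0$ and $f_c\in\mathbb{R}$, and let $I$ be a time interval $[0,T]$, $[0,T)$ (with $T>0$) or $[0,\infty)$. Let $h>0$ and $\mathbf u=[u,v]^T$ be continuously differentiable on $I\times\overline\Omega$ (derivatives up to the boundary) and solve the nonlinear rotating shallow water equations in vector-invariant form $$\partial_t h+\nabla\cdot\mathbf F=0,\qquad \partial_t\mathbf u+\omega\,\mathbf u^\perp+\nabla G=\mathbf 0\qquad\text{in } I\times\Omega,$$ where $\mathbf F=h\mathbf u$, $G=\tfrac12|\mathbf u|^2+gh$, $\omega=\partial_x v-\partial_y u+f_c$, $\mathbf u^\perp=[-v,u]^T$, with initial conditions $h|_{t=0}=h_0$, $\mathbf u|_{t=0}=\mathbf u_0$ in $\Omega$. Assume that the flow is subcritical, $|\mathbf u|/\sqrt{gh}<1$ on $I\times\overline\Omega$. On $\partial\Omega$ put $u_n=n_xu+n_yv$, $u_s=n_yu-n_xv$, $F_n=hu_n$, $G_n=\tfrac12u_n^2+gh$, and assume the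 boundary conditions with homogeneous data $$\alpha G_n-\beta F_n=0\ \text{ on } I\times\partial\Omega,\qquad\text{and in addition } u_s=0\ \text{ wherever } u_n<0,$$ where the weights $\alpha,\beta$ are real functions on $I\times\partial\Omega$ (so they may depend on the solution) with $\alpha\ge0$, $\beta\ge0$ and $|\alpha|^2+|\beta|^2>0$ at every point. Let $$E(t)=\int_\Omega\Big(\tfrac12h|\mathbf u|^2+\tfrac12gh^2\Big)\,d\Omega,\qquad \mathrm{BT}(t)=-\oint_{\partial\Omega}G\,F_n\,dS .$$ Then for every $t\in I$ both integrands are integrable, $E$ is differentiable at $t$ (one-sidedly at the end points of $I$), and $$\frac{d}{dt}E(t)=\mathrm{BT}(t)\le0 ;$$ consequently $E(t)\le E(0)$ for all $t\in I$. -/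

import Mathlib

open MeasureTheory Filter Topology Set

namespace RSWE

/-- The Euclidean plane `ℝ²`. -/
abbrev Plane := EuclideanSpace ℝ (Fin 2)

/-! ### Vector calculus in the plane -/

/-- The rotated vector `w^⊥ = [-w₂, w₁]`. -/
noncomputable def perp (w : Plane) : Plane := !₂[-(w 1), w 0]

/-- The partial derivative of a scalar field in the `i`-th coordinate direction. -/
noncomputable def partialDeriv (i : Fin 2) (f : Plane → ℝ) (x : Plane) : ℝ :=
  fderiv ℝ f x (EuclideanSpace.single i 1)

/-- The divergence of a planar vector field. -/
noncomputable def divergence (F : Plane → Plane) (x : Plane) : ℝ :=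
  partialDeriv 0 (fun y => F y 0) x + partialDeriv 1 (fun y => F y 1) x

/-- The scalar curl `∂v/∂x - ∂u/∂y` of a planar vector field `[u, v]`. -/
noncomputable def curl (w : Plane → Plane) (x : Plane) : ℝ :=
  partialDeriv 0 (fun y => w y 1) x - partialDeriv 1 (fun y => w y 0) x

/-! ### Domains with `C¹` boundary and the outward normal -/

/-- `Ω` has `C¹` boundary: near every boundary point, in suitable orthonormal coordinates, `Ω` is
the region strictly below the graph of a `C¹` function. -/
def HasC1Boundary (Ω : Set Plane) : Prop :=
  ∀ p ∈ frontier Ω, ∃ (R : Plane ≃ₗᵢ[ℝ] Plane) (φ : ℝ → ℝ) (U : Set Plane),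
    IsOpen U ∧ p ∈ U ∧ ContDiff ℝ 1 φ ∧ ∀ x ∈ U, x ∈ Ω ↔ R x 1 < φ (R x 0)

/-- `ν` is the outward unit normal of `Ω` at `p`: it has length one, every direction `w` with
`ν · w < 0` points from `p` into `Ω`, and every direction `w` with `ν · w > 0` points out of `Ω`. -/
def IsOutwardUnitNormalAt (Ω : Set Plane) (p ν : Plane) : Prop :=
  ‖ν‖ = 1 ∧
  (∀ w : Plane, inner ℝ ν w < 0 → ∀ᶠ s in 𝓝[>] (0 : ℝ), p + s • w ∈ Ω) ∧
  (∀ w : Plane, 0 < inner ℝ ν w → ∀ᶠ s in 𝓝[>] (0 : ℝ), p + s • w ∉ Ω)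

open Classical in
/-- The outward unit normal `n` of `Ω`. It exists at every boundary point of an open set with `C¹`
boundary and is unique, see `outwardNormal_spec` and `IsOutwardUnitNormalAt.unique`. -/
noncomputable def outwardNormal (Ω : Set Plane) (p : Plane) : Plane :=
  if H : ∃ ν, IsOutwardUnitNormalAt Ω p ν then H.choose else 0

theorem IsOutwardUnitNormalAt.unique {Ω : Set Plane} {p ν μ : Plane}
    (hν : IsOutwardUnitNormalAt Ω p ν) (hμ : IsOutwardUnitNormalAt Ω p μ) : ν = μ := by
  by_contra hne
  have h1 : inner ℝ ν μ < 1 :=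
    (inner_lt_one_iff_real_of_norm_eq_one hν.1 hμ.1).2 hne
  have a1 : inner ℝ ν (μ - ν) < 0 := by
    rw [inner_sub_right, real_inner_self_eq_norm_sq, hν.1]; linarith
  have a2 : 0 < inner ℝ μ (μ - ν) := by
    rw [inner_sub_right, real_inner_self_eq_norm_sq, hμ.1, real_inner_comm]; linarith
  obtain ⟨s, hs1, hs2⟩ := ((hν.2.1 _ a1).and (hμ.2.2 _ a2)).exists
  exact hs2 hs1

theorem outwardNormal_spec {Ω : Set Plane} (hΩ : IsOpen Ω) (hb : HasC1Boundary Ω)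
    {p : Plane} (hp : p ∈ frontier Ω) : IsOutwardUnitNormalAt Ω p (outwardNormal Ω p) := by
  have key : ∃ ν, IsOutwardUnitNormalAt Ω p ν := by
    obtain ⟨R, φ, U, hU, hpU, hφ, hiff⟩ := hb p hp
    have hcont : Continuous fun x : Plane => R x 1 - φ (R x 0) := by
      have := hφ.continuous
      fun_prop
    have hpΩ : p ∉ Ω := by
      rw [hΩ.frontier_eq] at hp; exact hp.2
    have hp0 : R p 1 - φ (R p 0) = 0 := by
      apply le_antisymm
      · by_contra hlt
        push Not at hlt
        have hev : ∀ᶠ x in 𝓝 p, x ∈ U ∧ 0 < R x 1 - φ (R x 0) :=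
          (show ∀ᶠ x in 𝓝 p, x ∈ U from hU.mem_nhds hpU).and (hcont.continuousAt.eventually (lt_mem_nhds hlt))
        have hcl : p ∈ closure Ω := frontier_subset_closure hp
        obtain ⟨x, hx, hxΩ⟩ := ((mem_closure_iff_frequently.1 hcl).and_eventually hev).exists
        have := (hiff x hxΩ.1).1 hx
        linarith [hxΩ.2]
      · have := mt (hiff p hpU).2 hpΩ
        linarith
    set d := deriv φ (R p 0) with hd
    set μ : Plane := !₂[-d, 1] with hμ
    have hμne : μ ≠ 0 := fun h => by
      have := congrArg (fun z : Plane => z 1) h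
      simp [hμ] at this
    have hμn : 0 < ‖μ‖ := norm_pos_iff.2 hμne
    have hinner : ∀ w : Plane, inner ℝ (R.symm (‖μ‖⁻¹ • μ)) w = ‖μ‖⁻¹ * (R w 1 - d * R w 0) := by
      intro w
      rw [← R.inner_map_map, R.apply_symm_apply, real_inner_smul_left]
      congr 1
      simp [hμ, PiLp.inner_apply, Fin.sum_univ_two]
      ring
    have hderiv : ∀ w : Plane, HasDerivAt
        (fun s : ℝ => R (p + s • w) 1 - φ (R (p + s • w) 0)) (R w 1 - d * R w 0) 0 := by
      intro w
      have e : ∀ i : Fin 2, HasDerivAt (fun s : ℝ => R (p + s • w) i) (R w i) 0 := by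
        intro i
        have : (fun s : ℝ => R (p + s • w) i) = fun s : ℝ => R p i + s * R w i := by
          funext s; simp
        rw [this]
        simpa using ((hasDerivAt_id (0 : ℝ)).mul_const (R w i)).const_add (R p i)
      have hφ' : HasDerivAt φ d (R (p + (0 : ℝ) • w) 0) := by
        simpa [hd] using (hφ.differentiable (by simp) (R p 0)).hasDerivAt
      exact (e 1).sub (hφ'.comp (0 : ℝ) (e 0))
    have hmemU : ∀ w : Plane, ∀ᶠ s in 𝓝[>] (0 : ℝ), p + s • w ∈ U := by
      intro w
      have hc : ContinuousAt (fun s : ℝ => p + s • w) 0 := by fun_prop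
      exact (hc.eventually (by simpa using hU.mem_nhds hpU)).filter_mono nhdsWithin_le_nhds
    have hslope : ∀ w : Plane, Tendsto
        (fun s : ℝ => s⁻¹ * (R (p + s • w) 1 - φ (R (p + s • w) 0))) (𝓝[>] 0)
        (𝓝 (R w 1 - d * R w 0)) := by
      intro w
      have := (hderiv w).tendsto_slope_zero_right
      simpa [hp0] using this
    refine ⟨R.symm (‖μ‖⁻¹ • μ), ?_, ?_, ?_⟩
    · rw [R.symm.norm_map, norm_smul, norm_inv, norm_norm, inv_mul_cancel₀ hμn.ne']
    · intro w hw
      rw [hinner] at hw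
      have hw' : R w 1 - d * R w 0 < 0 := by
        by_contra h
        push Not at h
        exact absurd hw (not_lt.2 (mul_nonneg (inv_nonneg.2 hμn.le) h))
      filter_upwards [hmemU w, (hslope w).eventually (gt_mem_nhds hw'), self_mem_nhdsWithin]
        with s hs1 hs2 hs3
      refine (hiff _ hs1).2 ?_
      have hs4 : 0 < s⁻¹ := inv_pos.2 hs3
      nlinarith
    · intro w hw
      rw [hinner] at hw
      have hw' : 0 < R w 1 - d * R w 0 := pos_of_mul_pos_right hw (inv_nonneg.2 hμn.le)
      filter_upwards [hmemU w, (hslope w).eventually (lt_mem_nhds hw'), self_mem_nhdsWithin]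
        with s hs1 hs2 hs3 hs5
      have hs6 := (hiff _ hs1).1 hs5
      have hs4 : 0 < s⁻¹ := inv_pos.2 hs3
      nlinarith
  rw [outwardNormal, dif_pos key]
  exact key.choose_spec

/-! ### The flow variables, the energy and the boundary term

`h` is the water height and `u` the velocity, as functions of the position at a fixed time. -/

/-- The mass flux `F = h u`. -/
noncomputable def massFlux (h : Plane → ℝ) (u : Plane → Plane) (x : Plane) : Plane :=
  h x • u x

/-- The Bernoulli potential `G = |u|²/2 + g h`. -/
noncomputable def bernoulliPotential (g : ℝ) (h : Plane → ℝ) (u : Plane → Plane) (x : Plane) : ℝ :=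
  1 / 2 * ‖u x‖ ^ 2 + g * h x

/-- The absolute vorticity `ω = curl u + f_c`. -/
noncomputable def absVorticity (fc : ℝ) (u : Plane → Plane) (x : Plane) : ℝ :=
  curl u x + fc

/-- The elemental energy `e = h |u|² / 2 + g h² / 2`. -/
noncomputable def elementalEnergy (g : ℝ) (h : Plane → ℝ) (u : Plane → Plane) (x : Plane) : ℝ :=
  1 / 2 * h x * ‖u x‖ ^ 2 + 1 / 2 * g * h x ^ 2

/-- The total energy `E = ∫_Ω e`. -/
noncomputable def energy (g : ℝ) (Ω : Set Plane) (h : Plane → ℝ) (u : Plane → Plane) : ℝ :=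
  ∫ x in Ω, elementalEnergy g h u x

/-- The normal velocity `u_n = n · u` on the boundary. -/
noncomputable def normalVelocity (Ω : Set Plane) (u : Plane → Plane) (x : Plane) : ℝ :=
  outwardNormal Ω x 0 * u x 0 + outwardNormal Ω x 1 * u x 1

/-- The tangential velocity `u_s = n_y u - n_x v` on the boundary. -/
noncomputable def tangentialVelocity (Ω : Set Plane) (u : Plane → Plane) (x : Plane) : ℝ :=
  outwardNormal Ω x 1 * u x 0 - outwardNormal Ω x 0 * u x 1

/-- The normal mass flux `F_n = h u_n`. -/
noncomputable def normalFlux (Ω : Set Plane) (h : Plane → ℝ) (u : Plane → Plane) (x : Plane) : ℝ :=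
  h x * normalVelocity Ω u x

/-- The normal Bernoulli potential `G_n = u_n² / 2 + g h`. -/
noncomputable def normalBernoulli (g : ℝ) (Ω : Set Plane) (h : Plane → ℝ) (u : Plane → Plane)
    (x : Plane) : ℝ :=
  1 / 2 * normalVelocity Ω u x ^ 2 + g * h x

/-- The boundary term `BT = - ∮_{∂Ω} G F_n dS`; arc length on the boundary is the one-dimensional
Hausdorff measure. -/
noncomputable def boundaryTerm (g : ℝ) (Ω : Set Plane) (h : Plane → ℝ) (u : Plane → Plane) : ℝ :=
  -∫ x in frontier Ω, bernoulliPotential g h u x * normalFlux Ω h u x ∂(Measure.hausdorffMeasure 1)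

/-! ### The initial boundary value problem -/

/-- A time interval starting at `0`: one of `[0, T]`, `[0, T)` with `T > 0`, or `[0, ∞)`. -/
def IsTimeInterval (I : Set ℝ) : Prop :=
  I.OrdConnected ∧ IsLeast I 0 ∧ I.Nontrivial

/-- `(h, u)` is a classical solution, continuously differentiable up to the boundary, of the
rotating shallow water equations in vector invariant form on `Ω` over the time interval `I`. -/
structure IsClassicalSolution (g fc : ℝ) (Ω : Set Plane) (I : Set ℝ)
    (h : ℝ → Plane → ℝ) (u : ℝ → Plane → Plane) : Prop where
  contDiffOn_h : ContDiffOn ℝ 1 (fun q : ℝ × Plane => h q.1 q.2) (I ×ˢ closure Ω)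
  contDiffOn_u : ContDiffOn ℝ 1 (fun q : ℝ × Plane => u q.1 q.2) (I ×ˢ closure Ω)
  height_pos : ∀ t ∈ I, ∀ x ∈ closure Ω, 0 < h t x
  mass : ∀ t ∈ I, ∀ x ∈ Ω,
    derivWithin (fun s => h s x) I t + divergence (massFlux (h t) (u t)) x = 0
  momentum : ∀ t ∈ I, ∀ x ∈ Ω,
    derivWithin (fun s => u s x) I t + absVorticity fc (u t) x • perp (u t x)
      + gradient (bernoulliPotential g (h t) (u t)) x = 0

/-- The flow is subcritical: the Froude number `Fr = |u| / √(g h)` is less than one. -/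
def IsSubcritical (g : ℝ) (Ω : Set Plane) (I : Set ℝ)
    (h : ℝ → Plane → ℝ) (u : ℝ → Plane → Plane) : Prop :=
  ∀ t ∈ I, ∀ x ∈ closure Ω, ‖u t x‖ / √(g * h t x) < 1

/-- The initial conditions `h = h₀` and `u = u₀` at time `0`. -/
def SatisfiesInitialCondition (Ω : Set Plane) (h₀ : Plane → ℝ) (u₀ : Plane → Plane)
    (h : ℝ → Plane → ℝ) (u : ℝ → Plane → Plane) : Prop :=
  ∀ x ∈ Ω, h 0 x = h₀ x ∧ u 0 x = u₀ x

/-- The boundary conditions with homogeneous data: `α G_n - β F_n = 0` on the whole boundary and,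
in addition, `u_s = 0` wherever `u_n < 0` (inflow). The weights `α`, `β` may vary with time and
with the boundary point, and so may depend on the solution. -/
def SatisfiesBoundaryCondition (g : ℝ) (Ω : Set Plane) (I : Set ℝ) (α β : ℝ → Plane → ℝ)
    (h : ℝ → Plane → ℝ) (u : ℝ → Plane → Plane) : Prop :=
  ∀ t ∈ I, ∀ x ∈ frontier Ω,
    α t x * normalBernoulli g Ω (h t) (u t) x - β t x * normalFlux Ω (h t) (u t) x = 0 ∧
    (normalVelocity Ω (u t) x < 0 → tangentialVelocity Ω (u t) x = 0)

end RSWE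

/-!
# Energy stability of the rotating shallow water equations

The elemental energy `e` satisfies the local balance `∂ₜ e = -∇ · (G F)`: multiply the mass equation
by `G` and the momentum equation by `F`, and use that `u^⊥` is orthogonal to `u`
(`IsClassicalSolution.derivWithin_elementalEnergy`). Differentiation under the integral
(`hasDerivWithinAt_setIntegral`) and the divergence theorem
(`setIntegral_divergence_eq_boundary`) turn it into `dE/dt = -∮ G Fₙ`. On the boundary
`α Gₙ = β Fₙ` with `Gₙ > 0` rules out `uₙ < 0`, since the two sides would have opposite signs and
both weights would vanish (`normalVelocity_nonneg`). Hence `G Fₙ ≥ 0`, and the energy decays.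

The analytic core is the divergence theorem on a bounded open set with `C¹` boundary, with arc length
given by the Hausdorff measure. It rests on the following two facts.

* Arc length formula (`comap_hausdorffMeasure_eq_withDensity`): a `C¹` curve stretches short
  intervals near `s` by nearly the factor `‖γ' s‖`, so the pulled back Hausdorff measure has this
  derivative with respect to Lebesgue measure at every point, and by the Besicovitch differentiation
  theorem this is its density.
* Gradient theorem in a chart (`IsGraphChart.setIntegral_fderiv`, `IsGraphChart.boundary_integral`):
  the measure preserving shear `(s, z) ↦ (s, z + φ s)` maps the lower half plane to the region below
  the graph of `φ`. Derivatives along the curves `z = const` integrate to zero, vertical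
  derivatives integrate to boundary values by the fundamental theorem of calculus, and the resulting
  weights are the components of the normal `(-φ', 1)`, whose length is the arc length density.

A partition of unity glues the charts (`setIntegral_fderiv_eq_boundary`). Only continuity on the
closure and a bounded derivative inside are needed there. For functions that are `C¹` up to the
boundary the bound comes from compactness, because `closure Ω` has unique derivatives
(`uniqueDiffOn_closure`).
-/

namespace RSWE

/-! ### Arc length of regular curves -/

/-- A map that expands distances on `s` by at least the factor `k` expands the one-dimensional
Hausdorff measure of `s` by at least `k`: its inverse on the image is `k⁻¹`-Lipschitz. -/
theorem mul_hausdorffMeasure_le_image {X Y : Type*} [MetricSpace X] [Nonempty X] [MetricSpace Y]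
    [MeasurableSpace X] [BorelSpace X] [MeasurableSpace Y] [BorelSpace Y]
    {γ : X → Y} {s : Set X} {k : NNReal} (h : ∀ a ∈ s, ∀ b ∈ s, k * dist a b ≤ dist (γ a) (γ b)) :
    k * Measure.hausdorffMeasure 1 s ≤ Measure.hausdorffMeasure 1 (γ '' s) := by
  rcases eq_or_ne k 0 with rfl | hk
  · simp
  have hkpos : (0 : ℝ) < k := by positivity
  have hinj : InjOn γ s := fun a ha b hb hab => by
    have := h a ha b hb
    rw [hab, dist_self] at this
    exact dist_le_zero.1 (nonpos_of_mul_nonpos_right this hkpos)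
  have hlip : LipschitzOnWith k⁻¹ (Function.invFunOn γ s) (γ '' s) := by
    refine LipschitzOnWith.of_dist_le_mul ?_
    rintro _ ⟨a, ha, rfl⟩ _ ⟨b, hb, rfl⟩
    rw [hinj.leftInvOn_invFunOn ha, hinj.leftInvOn_invFunOn hb, NNReal.coe_inv,
      inv_mul_eq_div, le_div_iff₀ hkpos, mul_comm]
    exact h a ha b hb
  have := hlip.hausdorffMeasure_image_le (d := 1) zero_le_one
  rw [hinj.leftInvOn_invFunOn.image_image] at this
  calc k * Measure.hausdorffMeasure 1 s
      ≤ k * ((k⁻¹ : NNReal) ^ (1 : ℝ) * Measure.hausdorffMeasure 1 (γ '' s)) := by gcongr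
    _ = Measure.hausdorffMeasure 1 (γ '' s) := by
      rw [ENNReal.rpow_one, ← mul_assoc, ← ENNReal.coe_mul, mul_inv_cancel₀ hk]; simp

variable {E : Type*} [NormedAddCommGroup E] [NormedSpace ℝ E] [MeasurableSpace E] [BorelSpace E]

/-- On short arcs around `x` a `C¹` curve stretches lengths by nearly the factor `‖γ' x‖`. -/
theorem eventually_hausdorffMeasure_image_bounds {γ : ℝ → E} (hγ : ContDiff ℝ 1 γ) (x : ℝ)
    {ε : NNReal} (hε : 0 < ε) :
    ∃ δ > 0, ∀ s ⊆ Metric.closedBall x δ,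
      (‖deriv γ x‖₊ - ε : NNReal) * volume s ≤ Measure.hausdorffMeasure 1 (γ '' s) ∧
      Measure.hausdorffMeasure 1 (γ '' s) ≤ (‖deriv γ x‖₊ + ε : NNReal) * volume s := by
  have hstrict : HasStrictDerivAt γ (deriv γ x) x :=
    hγ.contDiffAt.hasStrictDerivAt (by simp)
  have hst := hstrict.hasStrictFDerivAt.isLittleO.def (c := ε) hε
  rw [nhds_prod_eq, (Metric.nhds_basis_closedBall.prod_self).eventually_iff] at hst
  obtain ⟨δ, hδ, hb⟩ := hst
  have key : ∀ a ∈ Metric.closedBall x δ, ∀ b ∈ Metric.closedBall x δ,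
      ‖γ a - γ b - (a - b) • deriv γ x‖ ≤ ε * ‖a - b‖ := by
    intro a ha b hb'
    simpa using hb (x := (a, b)) ⟨ha, hb'⟩
  refine ⟨δ, hδ, fun s hs => ?_⟩
  rw [← hausdorffMeasure_real]
  constructor
  · refine mul_hausdorffMeasure_le_image fun a ha b hb' => ?_
    have h1 := key a (hs ha) b (hs hb')
    have h2 := norm_sub_norm_le ((a - b) • deriv γ x) (γ a - γ b)
    rw [norm_sub_rev _ (γ a - γ b), norm_smul] at h2
    rw [dist_eq_norm, dist_eq_norm, NNReal.coe_sub_def, max_mul_of_nonneg _ _ (norm_nonneg _),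
      zero_mul]
    refine max_le ?_ (norm_nonneg _)
    simp only [coe_nnnorm]
    linarith
  · have hlip : LipschitzOnWith (‖deriv γ x‖₊ + ε) γ s := by
      refine LipschitzOnWith.of_dist_le_mul fun a ha b hb' => ?_
      have h1 := key a (hs ha) b (hs hb')
      have h2 := norm_le_norm_add_norm_sub' (γ a - γ b) ((a - b) • deriv γ x)
      rw [norm_smul] at h2
      rw [dist_eq_norm, dist_eq_norm]
      push_cast
      linarith
    simpa using hlip.hausdorffMeasure_image_le (d := 1) zero_le_one

/-- **Arc length formula**: pulled back to the parameter, the one-dimensional Hausdorff measure on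
a `C¹` curve has density `‖γ'‖`. The density is identified by differentiating the measure. -/
theorem comap_hausdorffMeasure_eq_withDensity {γ : ℝ → E} (hγ : ContDiff ℝ 1 γ)
    (hemb : MeasurableEmbedding γ) :
    (Measure.hausdorffMeasure 1).comap γ
      = (volume : Measure ℝ).withDensity fun s => (‖deriv γ s‖₊ : ENNReal) := by
  set ν : Measure ℝ := (Measure.hausdorffMeasure 1).comap γ with hν
  have happ : ∀ s, ν s = Measure.hausdorffMeasure 1 (γ '' s) := hemb.comap_apply _
  have hfin : IsLocallyFiniteMeasure ν := by
    refine ⟨fun x => ?_⟩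
    obtain ⟨δ, hδ, hb⟩ := eventually_hausdorffMeasure_image_bounds hγ x one_pos
    refine ⟨_, Metric.closedBall_mem_nhds x hδ, ?_⟩
    rw [happ]
    refine (hb _ subset_rfl).2.trans_lt (ENNReal.mul_lt_top ENNReal.coe_lt_top ?_)
    exact measure_closedBall_lt_top
  have hac : ν ≪ volume := by
    intro s hs
    refine measure_null_of_locally_null s fun x _ => ?_
    obtain ⟨δ, hδ, hb⟩ := eventually_hausdorffMeasure_image_bounds hγ x one_pos
    refine ⟨s ∩ Metric.closedBall x δ,
      inter_mem self_mem_nhdsWithin (mem_nhdsWithin_of_mem_nhds (Metric.closedBall_mem_nhds x hδ)), ?_⟩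
    have := (hb _ (inter_subset_right (s := s))).2
    rw [measure_mono_null inter_subset_left hs, mul_zero] at this
    rw [happ]
    exact le_antisymm this zero_le
  have hlim : ∀ x, Tendsto
      (fun r => ν (Metric.closedBall x r) / volume (Metric.closedBall x r)) (𝓝[>] 0)
      (𝓝 (‖deriv γ x‖₊ : ENNReal)) := by
    intro x
    rw [ENNReal.tendsto_nhds ENNReal.coe_ne_top]
    intro ε hε
    obtain ⟨ε', hε', hle⟩ := ENNReal.lt_iff_exists_nnreal_btwn.1 hε
    obtain ⟨δ, hδ, hb⟩ := eventually_hausdorffMeasure_image_bounds hγ x (ENNReal.coe_pos.1 hε')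
    filter_upwards [Ioc_mem_nhdsGT hδ] with r hr
    have hvpos : volume (Metric.closedBall x r) ≠ 0 :=
      (Metric.measure_closedBall_pos _ _ hr.1).ne'
    have hvfin : volume (Metric.closedBall x r) ≠ ⊤ := measure_closedBall_lt_top.ne
    obtain ⟨h1, h2⟩ := hb _ (Metric.closedBall_subset_closedBall hr.2)
    rw [happ]
    constructor
    · refine le_trans ?_ ((ENNReal.le_div_iff_mul_le (Or.inl hvpos) (Or.inl hvfin)).2 h1)
      rw [ENNReal.coe_sub]
      gcongr
    · refine le_trans (ENNReal.div_le_of_le_mul h2) ?_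
      rw [ENNReal.coe_add]
      gcongr
  rw [← Measure.withDensity_rnDeriv_eq ν volume hac]
  refine withDensity_congr_ae ?_
  filter_upwards [Besicovitch.ae_tendsto_rnDeriv ν volume] with x hx
  exact tendsto_nhds_unique hx (hlim x)

/-- Line integrals over the image of an embedded `C¹` curve in terms of its parameter. -/
theorem setIntegral_range_hausdorffMeasure {γ : ℝ → E} (hγ : ContDiff ℝ 1 γ)
    (hemb : MeasurableEmbedding γ) (f : E → ℝ) :
    ∫ x in range γ, f x ∂(Measure.hausdorffMeasure 1) = ∫ s, ‖deriv γ s‖ * f (γ s) := by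
  have hm : Measurable fun s => ‖deriv γ s‖₊ := (hγ.continuous_deriv le_rfl).nnnorm.measurable
  rw [← hemb.map_comap, hemb.integral_map, comap_hausdorffMeasure_eq_withDensity hγ hemb,
    integral_withDensity_eq_integral_smul hm]
  rfl

theorem integrableOn_range_hausdorffMeasure_iff {γ : ℝ → E} (hγ : ContDiff ℝ 1 γ)
    (hemb : MeasurableEmbedding γ) (f : E → ℝ) :
    IntegrableOn f (range γ) (Measure.hausdorffMeasure 1)
      ↔ Integrable fun s => ‖deriv γ s‖ * f (γ s) := by
  have hm : Measurable fun s => ‖deriv γ s‖₊ := (hγ.continuous_deriv le_rfl).nnnorm.measurable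
  rw [IntegrableOn, ← hemb.map_comap, hemb.integrable_map_iff,
    comap_hausdorffMeasure_eq_withDensity hγ hemb, integrable_withDensity_iff_integrable_smul hm]
  rfl

/-! ### Graph coordinates -/

/-- The homeomorphism `(s, z) ↦ R⁻¹ (s, z + φ s)`: in the orthonormal coordinates `R` it shears the
lower half plane `z < 0` onto the region strictly below the graph of `φ`. -/
noncomputable def graphCoords (R : Plane ≃ₗᵢ[ℝ] Plane) {φ : ℝ → ℝ} (hφ : Continuous φ) :
    ℝ × ℝ ≃ₜ Plane where
  toFun q := R.symm !₂[q.1, q.2 + φ q.1]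
  invFun x := (R x 0, R x 1 - φ (R x 0))
  left_inv q := by simp
  right_inv x := by
    apply R.injective
    ext i
    fin_cases i <;> simp
  continuous_toFun := by
    refine R.symm.continuous.comp ((PiLp.continuous_toLp 2 _).comp (continuous_pi fun i => ?_))
    fin_cases i
    · exact continuous_fst
    · exact continuous_snd.add (hφ.comp continuous_fst)
  continuous_invFun := by fun_prop

section GraphCoords

variable (R : Plane ≃ₗᵢ[ℝ] Plane) {φ : ℝ → ℝ}

@[simp] theorem coord_graphCoords_zero (hφ : Continuous φ) (q : ℝ × ℝ) :
    R (graphCoords R hφ q) 0 = q.1 := by simp [graphCoords]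

@[simp] theorem coord_graphCoords_one (hφ : Continuous φ) (q : ℝ × ℝ) :
    R (graphCoords R hφ q) 1 = q.2 + φ q.1 := by simp [graphCoords]

theorem graphCoords_symm_apply (hφ : Continuous φ) (x : Plane) :
    (graphCoords R hφ).symm x = (R x 0, R x 1 - φ (R x 0)) := rfl

theorem measurePreserving_graphCoords (hφ : Continuous φ) :
    MeasurePreserving (graphCoords R hφ) := by
  have h1 : MeasurePreserving (fun q : ℝ × ℝ => (q.1, q.2 + φ q.1)) :=
    (MeasurePreserving.id volume).skew_product (g := fun s z => z + φ s)
      (by unfold Function.uncurry; fun_prop)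
      (Eventually.of_forall fun s => (measurePreserving_add_right volume (φ s)).map_eq)
  have h2 : MeasurePreserving (MeasurableEquiv.finTwoArrow (α := ℝ)).symm :=
    (volume_preserving_finTwoArrow ℝ).symm
  have h3 : MeasurePreserving (MeasurableEquiv.toLp 2 (Fin 2 → ℝ)) :=
    (EuclideanSpace.volume_preserving_symm_measurableEquiv_toLp (Fin 2)).symm
  have h4 : MeasurePreserving (R.symm : Plane → Plane) := R.symm.measurePreserving
  exact h4.comp (h3.comp (h2.comp h1))

theorem measurableEmbedding_graphCoords (hφ : Continuous φ) :
    MeasurableEmbedding (graphCoords R hφ) :=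
  (graphCoords R hφ).measurableEmbedding

theorem graphCoords_eq (hφ : Continuous φ) (q : ℝ × ℝ) :
    graphCoords R hφ q = q.1 • R.symm (EuclideanSpace.single 0 1)
      + (q.2 + φ q.1) • R.symm (EuclideanSpace.single 1 1) := by
  rw [← map_smul, ← map_smul, ← map_add]
  change R.symm _ = _
  congr 1
  ext i
  fin_cases i <;> simp

theorem hasDerivAt_graphCoords_snd (hφ : Continuous φ) (s z : ℝ) :
    HasDerivAt (fun z => graphCoords R hφ (s, z)) (R.symm (EuclideanSpace.single 1 1)) z := by
  simp_rw [graphCoords_eq]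
  simpa using (((hasDerivAt_id z).add_const (φ s)).smul_const
    (R.symm (EuclideanSpace.single 1 1))).const_add (s • R.symm (EuclideanSpace.single 0 1))

theorem hasDerivAt_graphCoords_fst (hφ : ContDiff ℝ 1 φ) (s z : ℝ) :
    HasDerivAt (fun s => graphCoords R hφ.continuous (s, z))
      (R.symm (EuclideanSpace.single 0 1) + deriv φ s • R.symm (EuclideanSpace.single 1 1)) s := by
  simp_rw [graphCoords_eq]
  have h1 : HasDerivAt φ (deriv φ s) s := (hφ.differentiable (by simp) s).hasDerivAt
  have h2 := (hasDerivAt_id s).smul_const (R.symm (EuclideanSpace.single 0 1))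
  rw [one_smul] at h2
  exact h2.add ((h1.const_add z).smul_const (R.symm (EuclideanSpace.single 1 1)))

/-- Every vector in terms of the direction of the curves `z = const`, which is tangential to the
graph, and of the vertical direction. -/
theorem eq_smul_tangent_add_smul_vertical (d : ℝ) (v : Plane) :
    v = R v 0 • (R.symm (EuclideanSpace.single 0 1) + d • R.symm (EuclideanSpace.single 1 1))
      + (R v 1 - R v 0 * d) • R.symm (EuclideanSpace.single 1 1) := by
  apply R.injective
  ext i
  fin_cases i
  · simp
  · simp

theorem contDiff_graphCoords_zero (hφ : ContDiff ℝ 1 φ) :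
    ContDiff ℝ 1 fun s => graphCoords R hφ.continuous (s, 0) := by
  simp_rw [graphCoords_eq]
  fun_prop

theorem measurableEmbedding_graph (hφ : Continuous φ) :
    MeasurableEmbedding fun s => graphCoords R hφ (s, 0) := by
  have h : IsClosedEmbedding fun s : ℝ => (s, (0 : ℝ)) :=
    .of_continuous_injective_isClosedMap (by fun_prop) (fun a b h => congrArg Prod.fst h)
      (isClosedMap_prodMk_right 0)
  exact ((graphCoords R hφ).isClosedEmbedding.comp h).measurableEmbedding

theorem mem_range_graph_iff (hφ : Continuous φ) (x : Plane) :
    x ∈ range (fun s => graphCoords R hφ (s, 0)) ↔ R x 1 = φ (R x 0) := by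
  constructor
  · rintro ⟨s, rfl⟩
    simp
  · intro h
    refine ⟨R x 0, ?_⟩
    apply R.injective
    ext i
    fin_cases i
    · simp
    · simp [h]

end GraphCoords

/-! ### Integration over the lower half plane -/

/-- A measurable function that vanishes off a compact set `K` and is bounded on `A ∩ K` is
integrable on `A`. -/
theorem integrableOn_of_bounded_of_eq_zero_off {X : Type*} [TopologicalSpace X] [T2Space X]
    [MeasurableSpace X] [BorelSpace X] {μ : Measure X} [IsFiniteMeasureOnCompacts μ]
    {A K : Set X} (hA : MeasurableSet A) (hK : IsCompact K) {f : X → ℝ} (hf : Measurable f)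
    (h0 : ∀ x ∉ K, f x = 0) {C : ℝ} (hC : ∀ x ∈ A, x ∈ K → |f x| ≤ C) : IntegrableOn f A μ := by
  have h1 : IntegrableOn f (A ∩ K) μ := by
    refine Measure.integrableOn_of_bounded (M := C)
      (measure_mono inter_subset_right |>.trans_lt hK.measure_lt_top).ne
      hf.aestronglyMeasurable ?_
    refine ae_restrict_of_forall_mem (hA.inter hK.measurableSet) fun x hx => hC x hx.1 hx.2
  refine h1.of_forall_sdiff_eq_zero hA fun x hx => h0 x fun hxK => hx.2 ⟨hx.1, hxK⟩

/-- The integral of a derivative in the direction parallel to the boundary of the half plane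
vanishes. -/
theorem setIntegral_halfPlane_deriv_fst {p p' : ℝ × ℝ → ℝ} {K : Set (ℝ × ℝ)} (hK : IsCompact K)
    (hp0 : ∀ q ∉ K, p q = 0)
    (hp : ∀ s, ∀ z < 0, HasDerivAt (fun s => p (s, z)) (p' (s, z)) s)
    (hint : IntegrableOn p' (univ ×ˢ Iio 0)) :
    ∫ q in univ ×ˢ Iio 0, p' q = 0 := by
  rw [IntegrableOn, Measure.volume_eq_prod, ← Measure.prod_restrict, Measure.restrict_univ] at hint
  rw [Measure.volume_eq_prod, ← Measure.prod_restrict, Measure.restrict_univ,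
    integral_prod_symm _ hint]
  refine integral_eq_zero_of_ae ?_
  filter_upwards [hint.prod_left_ae, ae_restrict_mem measurableSet_Iio] with z hz hz0
  have hcont : Continuous fun s => p (s, z) :=
    continuous_iff_continuousAt.2 fun s => (hp s z hz0).continuousAt
  have hsupp : HasCompactSupport fun s => p (s, z) := by
    refine HasCompactSupport.intro (hK.image continuous_fst) fun s hs => hp0 _ fun h => hs ?_
    exact ⟨_, h, rfl⟩
  exact integral_eq_zero_of_hasDerivAt_of_integrable (fun s => hp s z hz0) hz
    (hcont.integrable_of_hasCompactSupport hsupp)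

/-- The integral of a derivative in the direction transversal to the boundary of the half plane,
with a weight that is constant in that direction, is a boundary integral. -/
theorem setIntegral_halfPlane_deriv_snd {p p' : ℝ × ℝ → ℝ} {K : Set (ℝ × ℝ)} (hK : IsCompact K)
    (hp0 : ∀ q ∉ K, p q = 0)
    (hcont : ContinuousOn p (univ ×ˢ Iic 0))
    (hp : ∀ s, ∀ z < 0, HasDerivAt (fun z => p (s, z)) (p' (s, z)) z) (c : ℝ → ℝ)
    (hint : IntegrableOn (fun q => c q.1 * p' q) (univ ×ˢ Iio 0)) :
    ∫ q in univ ×ˢ Iio 0, c q.1 * p' q = ∫ s, c s * p (s, 0) := by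
  rw [IntegrableOn, Measure.volume_eq_prod, ← Measure.prod_restrict, Measure.restrict_univ] at hint
  rw [Measure.volume_eq_prod, ← Measure.prod_restrict, Measure.restrict_univ, integral_prod _ hint]
  refine integral_congr_ae ?_
  filter_upwards [hint.prod_right_ae] with s hs
  have h1 : ContinuousWithinAt (fun z => c s * p (s, z)) (Iic 0) 0 := by
    have h2 : ContinuousOn (fun z => p (s, z)) (Iic 0) :=
      hcont.comp (by fun_prop) fun z hz => ⟨mem_univ _, hz⟩
    exact continuousWithinAt_const.mul (h2 0 self_mem_Iic)
  have h3 : Tendsto (fun z => c s * p (s, z)) atBot (𝓝 0) := by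
    obtain ⟨m, hm⟩ := (hK.image continuous_snd).bddBelow
    refine tendsto_const_nhds.congr' ?_
    filter_upwards [eventually_lt_atBot m] with z hz
    rw [hp0 _ fun h => (hm ⟨_, h, rfl⟩).not_gt hz, mul_zero]
  have h4 : IntegrableOn (fun z => c s * p' (s, z)) (Iic 0) :=
    (integrableOn_Iic_iff_integrableOn_Iio).2 hs
  have := integral_Iic_of_hasDerivAt_of_tendsto h1 (fun z hz => (hp s z hz).const_mul (c s)) h4 h3
  rw [sub_zero, integral_Iic_eq_integral_Iio] at this
  exact this

/-! ### Boundary charts -/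

/-- A chart of `Ω`: on the open set `U`, in the orthonormal coordinates `R`, the set `Ω` is the
region strictly below the graph of the `C¹` function `φ`. -/
structure IsGraphChart (Ω : Set Plane) (R : Plane ≃ₗᵢ[ℝ] Plane) (φ : ℝ → ℝ) (U : Set Plane) :
    Prop where
  isOpen : IsOpen U
  contDiff : ContDiff ℝ 1 φ
  mem_iff : ∀ x ∈ U, x ∈ Ω ↔ R x 1 < φ (R x 0)

theorem IsGraphChart.inter {Ω : Set Plane} {R : Plane ≃ₗᵢ[ℝ] Plane} {φ : ℝ → ℝ} {U : Set Plane}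
    (hc : IsGraphChart Ω R φ U) {V : Set Plane} (hV : IsOpen V) : IsGraphChart Ω R φ (U ∩ V) :=
  ⟨hc.isOpen.inter hV, hc.contDiff, fun x hx => hc.mem_iff x hx.1⟩

section Chart

variable {Ω : Set Plane} {R : Plane ≃ₗᵢ[ℝ] Plane} {φ : ℝ → ℝ} {U : Set Plane}

theorem IsGraphChart.mem_closure_iff (hc : IsGraphChart Ω R φ U) {x : Plane} (hx : x ∈ U) :
    x ∈ closure Ω ↔ R x 1 ≤ φ (R x 0) := by
  set Ψ := graphCoords R hc.contDiff.continuous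
  have h1 : x ∈ closure Ω ↔ x ∈ closure {y | R y 1 < φ (R y 0)} := by
    rw [mem_closure_iff_frequently, mem_closure_iff_frequently]
    refine frequently_congr ?_
    filter_upwards [hc.isOpen.mem_nhds hx] with y hy using hc.mem_iff y hy
  have h2 : {y | R y 1 < φ (R y 0)} = Ψ.symm ⁻¹' (univ ×ˢ Iio 0) := by
    ext y
    simp [Ψ, graphCoords_symm_apply]
  rw [h1, h2, ← Ψ.symm.preimage_closure, closure_prod_eq, closure_Iio, closure_univ]
  simp [Ψ, graphCoords_symm_apply]

theorem IsGraphChart.mem_frontier_iff (hc : IsGraphChart Ω R φ U) (hΩ : IsOpen Ω) {x : Plane}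
    (hx : x ∈ U) : x ∈ frontier Ω ↔ R x 1 = φ (R x 0) := by
  rw [hΩ.frontier_eq, Set.mem_sdiff, hc.mem_closure_iff hx, hc.mem_iff x hx, not_lt, le_antisymm_iff]

/-- The vector `(-d, 1)`, normal to the lines of slope `d` and pointing upwards. -/
noncomputable def slopeVector (d : ℝ) : Plane := !₂[-d, 1]

theorem norm_slopeVector_pos (d : ℝ) : 0 < ‖slopeVector d‖ := by
  refine norm_pos_iff.2 fun h => ?_
  have := congrArg (fun z : Plane => z 1) h
  simp [slopeVector] at this

theorem inner_symm_slopeVector (R : Plane ≃ₗᵢ[ℝ] Plane) (d : ℝ) (w : Plane) :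
    inner ℝ (R.symm (‖slopeVector d‖⁻¹ • slopeVector d)) w
      = ‖slopeVector d‖⁻¹ * (R w 1 - R w 0 * d) := by
  rw [← R.inner_map_map, R.apply_symm_apply, real_inner_smul_left]
  congr 1
  simp [slopeVector, PiLp.inner_apply, Fin.sum_univ_two]
  ring

/-- In a chart the outward unit normal is the normalized vector `(-φ', 1)`. -/
theorem IsGraphChart.outwardNormal_eq (hc : IsGraphChart Ω R φ U) (hΩ : IsOpen Ω)
    (hb : HasC1Boundary Ω) {p : Plane} (hp : p ∈ frontier Ω) (hpU : p ∈ U) :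
    outwardNormal Ω p = R.symm (‖slopeVector (deriv φ (R p 0))‖⁻¹ •
      slopeVector (deriv φ (R p 0))) := by
  refine (outwardNormal_spec hΩ hb hp).unique ?_
  set d := deriv φ (R p 0) with hd
  have hp0 : R p 1 - φ (R p 0) = 0 := sub_eq_zero.2 ((hc.mem_frontier_iff hΩ hpU).1 hp)
  have hn : 0 < ‖slopeVector d‖ := norm_slopeVector_pos d
  have hderiv : ∀ w : Plane, HasDerivAt
      (fun s : ℝ => R (p + s • w) 1 - φ (R (p + s • w) 0)) (R w 1 - R w 0 * d) 0 := by
    intro w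
    have e : ∀ i : Fin 2, HasDerivAt (fun s : ℝ => R (p + s • w) i) (R w i) 0 := by
      intro i
      have : (fun s : ℝ => R (p + s • w) i) = fun s : ℝ => R p i + s * R w i := by
        funext s; simp
      rw [this]
      simpa using ((hasDerivAt_id (0 : ℝ)).mul_const (R w i)).const_add (R p i)
    have hφ' : HasDerivAt φ d (R (p + (0 : ℝ) • w) 0) := by
      simpa [hd] using (hc.contDiff.differentiable (by simp) (R p 0)).hasDerivAt
    rw [mul_comm]
    exact (e 1).sub (hφ'.comp (0 : ℝ) (e 0))
  have hmemU : ∀ w : Plane, ∀ᶠ s in 𝓝[>] (0 : ℝ), p + s • w ∈ U := by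
    intro w
    have hcw : ContinuousAt (fun s : ℝ => p + s • w) 0 := by fun_prop
    exact (hcw.eventually (by simpa using hc.isOpen.mem_nhds hpU)).filter_mono nhdsWithin_le_nhds
  have hslope : ∀ w : Plane, Tendsto
      (fun s : ℝ => s⁻¹ * (R (p + s • w) 1 - φ (R (p + s • w) 0))) (𝓝[>] 0)
      (𝓝 (R w 1 - R w 0 * d)) := by
    intro w
    have := (hderiv w).tendsto_slope_zero_right
    simpa [hp0] using this
  -- `R x 1 - φ (R x 0)` is negative inside; its sign along a ray is that of its derivative at `p`.
  refine ⟨?_, fun w hw => ?_, fun w hw => ?_⟩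
  · rw [R.symm.norm_map, norm_smul, norm_inv, norm_norm, inv_mul_cancel₀ hn.ne']
  · rw [inner_symm_slopeVector, ← smul_eq_mul, smul_neg_iff_of_pos_left (inv_pos.2 hn)] at hw
    filter_upwards [hmemU w, (hslope w).eventually (gt_mem_nhds hw), self_mem_nhdsWithin]
      with s hs1 hs2 hs3
    have := neg_of_mul_neg_right hs2 (inv_nonneg.2 (le_of_lt hs3))
    exact (hc.mem_iff _ hs1).2 (by linarith)
  · rw [inner_symm_slopeVector, mul_pos_iff_of_pos_left (inv_pos.2 hn)] at hw
    filter_upwards [hmemU w, (hslope w).eventually (lt_mem_nhds hw), self_mem_nhdsWithin]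
      with s hs1 hs2 hs3 hs5
    have h6 := pos_of_mul_pos_right hs2 (inv_nonneg.2 (le_of_lt hs3))
    linarith [(hc.mem_iff _ hs1).1 hs5]

end Chart

/-! ### The gradient theorem in a chart -/

section LocalGradient

variable {Ω : Set Plane} {R : Plane ≃ₗᵢ[ℝ] Plane} {φ : ℝ → ℝ} {U : Set Plane}
  {f : Plane → ℝ} {K : Set Plane}

/-- A function that vanishes off a closed set vanishes near every point outside that set. -/
theorem eventuallyEq_zero_of_notMem {X : Type*} [TopologicalSpace X] {K : Set X} (hK : IsClosed K)
    {f : X → ℝ} (hf0 : ∀ x ∉ K, f x = 0) {x : X} (hx : x ∉ K) : f =ᶠ[𝓝 x] fun _ => 0 := by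
  filter_upwards [hK.isOpen_compl.mem_nhds hx] with y hy using hf0 y hy

theorem fderiv_eq_zero_of_notMem (hK : IsClosed K) (hf0 : ∀ x ∉ K, f x = 0) {x : Plane}
    (hx : x ∉ K) : fderiv ℝ f x = 0 := by
  rw [(eventuallyEq_zero_of_notMem hK hf0 hx).fderiv_eq, fderiv_fun_const]
  rfl

theorem IsGraphChart.graphCoords_mem (hc : IsGraphChart Ω R φ U) {q : ℝ × ℝ} (hq : q.2 < 0)
    (hqU : graphCoords R hc.contDiff.continuous q ∈ U) :
    graphCoords R hc.contDiff.continuous q ∈ Ω := by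
  rw [hc.mem_iff _ hqU]
  simpa using hq

theorem IsGraphChart.graphCoords_mem_closure (hc : IsGraphChart Ω R φ U) {q : ℝ × ℝ}
    (hq : q.2 ≤ 0) (hqU : graphCoords R hc.contDiff.continuous q ∈ U) :
    graphCoords R hc.contDiff.continuous q ∈ closure Ω := by
  rw [hc.mem_closure_iff hqU]
  simpa using hq

theorem IsGraphChart.differentiableAt_graphCoords (hc : IsGraphChart Ω R φ U) (hΩ : IsOpen Ω)
    (hK : IsClosed K) (hKU : K ⊆ U) (hf0 : ∀ x ∉ K, f x = 0) (hd : DifferentiableOn ℝ f Ω)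
    {q : ℝ × ℝ} (hq : q.2 < 0) :
    DifferentiableAt ℝ f (graphCoords R hc.contDiff.continuous q) := by
  by_cases hqK : graphCoords R hc.contDiff.continuous q ∈ K
  · exact hd.differentiableAt (hΩ.mem_nhds (hc.graphCoords_mem hq (hKU hqK)))
  · exact (eventuallyEq_zero_of_notMem hK hf0 hqK).differentiableAt_iff.2
      (differentiableAt_const _)

theorem IsGraphChart.continuousOn_comp_graphCoords (hc : IsGraphChart Ω R φ U)
    (hK : IsClosed K) (hKU : K ⊆ U) (hf0 : ∀ x ∉ K, f x = 0) (hf : ContinuousOn f (closure Ω)) :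
    ContinuousOn (fun q => f (graphCoords R hc.contDiff.continuous q)) (univ ×ˢ Iic 0) := by
  set Ψ := graphCoords R hc.contDiff.continuous
  intro q hq
  by_cases hqK : Ψ q ∈ K
  · have h1 : ContinuousWithinAt f (closure Ω) (Ψ q) :=
      hf _ (hc.graphCoords_mem_closure hq.2 (hKU hqK))
    refine h1.tendsto.comp (tendsto_nhdsWithin_iff.2 ⟨Ψ.continuous.continuousWithinAt, ?_⟩)
    filter_upwards [self_mem_nhdsWithin, mem_nhdsWithin_of_mem_nhds
      (Ψ.continuous.continuousAt.preimage_mem_nhds (hc.isOpen.mem_nhds (hKU hqK)))] with r hr hrU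
    exact hc.graphCoords_mem_closure hr.2 hrU
  · refine ContinuousAt.continuousWithinAt ?_
    exact (continuousAt_const.congr (eventuallyEq_zero_of_notMem hK hf0 hqK).symm).comp
      Ψ.continuous.continuousAt

theorem IsGraphChart.integrableOn_weight_mul_fderiv (hc : IsGraphChart Ω R φ U)
    (hK : IsCompact K) (hKU : K ⊆ U) (hf0 : ∀ x ∉ K, f x = 0)
    {C : ℝ} (hC : ∀ x ∈ Ω, ‖fderiv ℝ f x‖ ≤ C) {c : ℝ → ℝ} (hcc : Continuous c) (w : Plane) :
    IntegrableOn (fun q => c q.1 * fderiv ℝ f (graphCoords R hc.contDiff.continuous q) w)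
      (univ ×ˢ Iio 0) := by
  set Ψ := graphCoords R hc.contDiff.continuous
  have hK' : IsCompact (Ψ ⁻¹' K) := Ψ.isCompact_preimage.2 hK
  obtain ⟨B, hB⟩ := hK'.exists_bound_of_continuousOn (hcc.comp continuous_fst).continuousOn
  refine integrableOn_of_bounded_of_eq_zero_off (MeasurableSet.univ.prod measurableSet_Iio) hK'
    ?_ ?_ (C := B * (C * ‖w‖)) ?_
  · exact (hcc.measurable.comp measurable_fst).mul
      ((measurable_fderiv_apply_const ℝ f w).comp Ψ.continuous.measurable)
  · intro q hq
    rw [fderiv_eq_zero_of_notMem hK.isClosed hf0 hq]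
    simp
  · intro q hq hqK
    rw [abs_mul]
    refine mul_le_mul (hB q hqK) ?_ (abs_nonneg _) ((norm_nonneg _).trans (hB q hqK))
    exact (fderiv ℝ f (Ψ q)).le_of_opNorm_le (hC _ (hc.graphCoords_mem hq.2 (hKU hqK))) w

/-- The area integral of a directional derivative, for a function supported in one chart, as an
integral over the parameter of the boundary curve. The direction is split into a multiple of the
tangential direction, whose contribution vanishes, and of the vertical one. -/
theorem IsGraphChart.setIntegral_fderiv (hc : IsGraphChart Ω R φ U) (hΩ : IsOpen Ω)
    (hK : IsCompact K) (hKU : K ⊆ U) (hf0 : ∀ x ∉ K, f x = 0) (hf : ContinuousOn f (closure Ω))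
    (hd : DifferentiableOn ℝ f Ω) {C : ℝ} (hC : ∀ x ∈ Ω, ‖fderiv ℝ f x‖ ≤ C) (v : Plane) :
    ∫ x in Ω, fderiv ℝ f x v
      = ∫ s, (R v 1 - R v 0 * deriv φ s) * f (graphCoords R hc.contDiff.continuous (s, 0)) := by
  set Ψ := graphCoords R hc.contDiff.continuous with hΨ
  set e₀ : Plane := R.symm (EuclideanSpace.single 0 1)
  set e₁ : Plane := R.symm (EuclideanSpace.single 1 1)
  have hK' : IsCompact (Ψ ⁻¹' K) := Ψ.isCompact_preimage.2 hK
  have hφ' : Continuous (deriv φ) := hc.contDiff.continuous_deriv le_rfl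
  have hdiff : ∀ s, ∀ z < 0, DifferentiableAt ℝ f (Ψ (s, z)) := fun s z hz =>
    hc.differentiableAt_graphCoords hΩ hK.isClosed hKU hf0 hd hz
  have hint := fun {c : ℝ → ℝ} (hcc : Continuous c) (w : Plane) =>
    hc.integrableOn_weight_mul_fderiv hK hKU hf0 hC hcc w
  -- `Ω` and the region below the graph agree on `U`, and the derivative of `f` vanishes off `K ⊆ U`.
  have hset : ∫ x in Ω, fderiv ℝ f x v = ∫ q in univ ×ˢ Iio 0, fderiv ℝ f (Ψ q) v := by
    have h1 : Ψ ⁻¹' (Ψ.symm ⁻¹' (univ ×ˢ Iio 0)) = univ ×ˢ Iio 0 := by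
      rw [← preimage_comp, Ψ.symm_comp_self, preimage_id]
    rw [← h1, (measurePreserving_graphCoords R hc.contDiff.continuous).setIntegral_preimage_emb
      (measurableEmbedding_graphCoords R _) (fun x => fderiv ℝ f x v),
      ← integral_indicator hΩ.measurableSet, ← integral_indicator
        ((MeasurableSet.univ.prod measurableSet_Iio).preimage Ψ.symm.continuous.measurable)]
    congr 1
    funext x
    by_cases hx : x ∈ K
    · have : x ∈ Ω ↔ x ∈ Ψ.symm ⁻¹' (univ ×ˢ Iio 0) := by
        rw [hc.mem_iff x (hKU hx)]
        simp [hΨ, graphCoords_symm_apply]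
      by_cases h : x ∈ Ω
      · rw [indicator_of_mem h, indicator_of_mem (this.1 h)]
      · rw [indicator_of_notMem h, indicator_of_notMem (mt this.2 h)]
    · simp [indicator, fderiv_eq_zero_of_notMem hK.isClosed hf0 hx]
  -- The vector `e₀ + φ' e₁` is the velocity of the curve `s ↦ Ψ (s, z)`.
  have htan : ∫ q in univ ×ˢ Iio 0, fderiv ℝ f (Ψ q) (e₀ + deriv φ q.1 • e₁) = 0 := by
    refine setIntegral_halfPlane_deriv_fst hK' (p := fun q => f (Ψ q)) (fun q hq => hf0 _ hq)
      (fun s z hz => ?_) ?_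
    · exact (hdiff s z hz).hasFDerivAt.comp_hasDerivAt s
        (hasDerivAt_graphCoords_fst R hc.contDiff s z)
    · refine ((hint continuous_const (c := fun _ => 1) e₀).add (hint hφ' e₁)).congr_fun
        (fun q _ => ?_) (MeasurableSet.univ.prod measurableSet_Iio)
      simp [hΨ]
  have hwt : Continuous fun s => R v 1 - R v 0 * deriv φ s := continuous_const.sub (hφ'.const_mul _)
  have hver : ∫ q in univ ×ˢ Iio 0, (R v 1 - R v 0 * deriv φ q.1) * fderiv ℝ f (Ψ q) e₁
      = ∫ s, (R v 1 - R v 0 * deriv φ s) * f (Ψ (s, 0)) := by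
    refine setIntegral_halfPlane_deriv_snd hK' (p := fun q => f (Ψ q)) (fun q hq => hf0 _ hq)
      (hc.continuousOn_comp_graphCoords hK.isClosed hKU hf0 hf) (fun s z hz => ?_)
      (fun s => R v 1 - R v 0 * deriv φ s) (hint hwt e₁)
    exact (hdiff s z hz).hasFDerivAt.comp_hasDerivAt z
      (hasDerivAt_graphCoords_snd R hc.contDiff.continuous s z)
  have hsplit : ∀ q : ℝ × ℝ, fderiv ℝ f (Ψ q) v
      = R v 0 * fderiv ℝ f (Ψ q) (e₀ + deriv φ q.1 • e₁)
        + (R v 1 - R v 0 * deriv φ q.1) * fderiv ℝ f (Ψ q) e₁ := by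
    intro q
    conv_lhs => rw [eq_smul_tangent_add_smul_vertical R (deriv φ q.1) v]
    rw [map_add, map_smul, map_smul]
    rfl
  have hint1 : IntegrableOn (fun q => R v 0 * fderiv ℝ f (Ψ q) (e₀ + deriv φ q.1 • e₁))
      (univ ×ˢ Iio 0) := by
    refine ((hint continuous_const (c := fun _ => R v 0) e₀).add
      (hint (hφ'.const_mul (R v 0)) e₁)).congr_fun
        (fun q _ => ?_) (MeasurableSet.univ.prod measurableSet_Iio)
    simp [hΨ]
    ring
  rw [hset, ← hver]
  simp_rw [hsplit]
  rw [integral_add hint1 (hint hwt e₁), integral_const_mul, htan, mul_zero, zero_add]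

/-- The boundary integrand of a function supported in one chart: it is integrable, and its arc
length integral is the integral over the parameter of the boundary curve. -/
theorem IsGraphChart.boundary_integral (hc : IsGraphChart Ω R φ U) (hΩ : IsOpen Ω)
    (hb : HasC1Boundary Ω)
    (hK : IsCompact K) (hKU : K ⊆ U) (hf0 : ∀ x ∉ K, f x = 0) (hf : ContinuousOn f (closure Ω))
    (v : Plane) :
    IntegrableOn (fun x => f x * inner ℝ (outwardNormal Ω x) v) (frontier Ω)
      (Measure.hausdorffMeasure 1) ∧
    ∫ x in frontier Ω, f x * inner ℝ (outwardNormal Ω x) v ∂(Measure.hausdorffMeasure 1)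
      = ∫ s, (R v 1 - R v 0 * deriv φ s) * f (graphCoords R hc.contDiff.continuous (s, 0)) := by
  set Ψ := graphCoords R hc.contDiff.continuous with hΨ
  set G : Plane → ℝ := fun x => f x * inner ℝ (outwardNormal Ω x) v
  have hφ' : Continuous (deriv φ) := hc.contDiff.continuous_deriv le_rfl
  have hγ : ContDiff ℝ 1 fun s => Ψ (s, 0) := contDiff_graphCoords_zero R hc.contDiff
  have hemb : MeasurableEmbedding fun s => Ψ (s, 0) := measurableEmbedding_graph R _
  have hind : (frontier Ω).indicator G = (range fun s => Ψ (s, 0)).indicator G := by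
    funext x
    by_cases hx : x ∈ K
    · have : x ∈ frontier Ω ↔ x ∈ range fun s => Ψ (s, 0) := by
        rw [hc.mem_frontier_iff hΩ (hKU hx), mem_range_graph_iff]
      by_cases h : x ∈ frontier Ω
      · rw [indicator_of_mem h, indicator_of_mem (this.1 h)]
      · rw [indicator_of_notMem h, indicator_of_notMem (mt this.2 h)]
    · simp [indicator, G, hf0 x hx]
  have hspeed : ∀ s, ‖deriv (fun s => Ψ (s, 0)) s‖ = ‖slopeVector (deriv φ s)‖ := by
    intro s
    rw [(hasDerivAt_graphCoords_fst R hc.contDiff s 0).deriv, ← map_smul, ← map_add,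
      R.symm.norm_map, EuclideanSpace.norm_eq, EuclideanSpace.norm_eq]
    simp [slopeVector, Fin.sum_univ_two, add_comm]
  -- The arc length density cancels the normalization of the outward normal.
  have hpt : ∀ s, ‖deriv (fun s => Ψ (s, 0)) s‖ * G (Ψ (s, 0))
      = (R v 1 - R v 0 * deriv φ s) * f (Ψ (s, 0)) := by
    intro s
    by_cases hx : Ψ (s, 0) ∈ K
    · have hfr : Ψ (s, 0) ∈ frontier Ω := by
        rw [hc.mem_frontier_iff hΩ (hKU hx)]
        simp [hΨ]
      have hs0 : R (Ψ (s, 0)) 0 = s := by simp [hΨ]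
      simp only [G]
      rw [hspeed, hc.outwardNormal_eq hΩ hb hfr (hKU hx), inner_symm_slopeVector, hs0]
      field_simp [(norm_slopeVector_pos (deriv φ s)).ne']
    · simp [G, hf0 _ hx]
  have hcont : Continuous fun s => f (Ψ (s, 0)) := by
    have h1 := hc.continuousOn_comp_graphCoords hK.isClosed hKU hf0 hf
    exact h1.comp_continuous (by fun_prop) fun s => ⟨mem_univ _, self_mem_Iic⟩
  have hsupp : HasCompactSupport fun s => (R v 1 - R v 0 * deriv φ s) * f (Ψ (s, 0)) := by
    refine HasCompactSupport.intro ((Ψ.isCompact_preimage.2 hK).image continuous_fst)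
      fun s hs => ?_
    rw [hf0 _ fun h => hs ⟨(s, 0), h, rfl⟩, mul_zero]
  constructor
  · rw [← integrable_indicator_iff measurableSet_frontier, hind,
      integrable_indicator_iff hemb.measurableSet_range,
      integrableOn_range_hausdorffMeasure_iff hγ hemb]
    simp_rw [hpt]
    exact (continuous_const.sub (hφ'.const_mul (R v 0))).mul hcont
      |>.integrable_of_hasCompactSupport hsupp
  · rw [← integral_indicator measurableSet_frontier, hind,
      integral_indicator hemb.measurableSet_range, setIntegral_range_hausdorffMeasure hγ hemb]
    simp_rw [hpt]

end LocalGradient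

/-! ### The gradient theorem and the divergence theorem -/

section Gradient

variable {Ω : Set Plane}

/-- Every point of `closure Ω` has a bounded chart. At an interior point the graph is a horizontal
line above a small disc. -/
theorem exists_isGraphChart (hΩ : IsOpen Ω) (hb : HasC1Boundary Ω) {p : Plane}
    (hp : p ∈ closure Ω) :
    ∃ (R : Plane ≃ₗᵢ[ℝ] Plane) (φ : ℝ → ℝ) (U : Set Plane),
      IsGraphChart Ω R φ U ∧ p ∈ U ∧ Bornology.IsBounded U := by
  by_cases hpΩ : p ∈ Ω
  · obtain ⟨r, hr, hball⟩ := Metric.isOpen_iff.1 hΩ p hpΩ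
    refine ⟨LinearIsometryEquiv.refl ℝ Plane, fun _ => p 1 + r, Metric.ball p r,
      ⟨Metric.isOpen_ball, contDiff_const, fun x hx => iff_of_true (hball hx) ?_⟩,
      Metric.mem_ball_self hr, Metric.isBounded_ball⟩
    have h1 : ‖(x - p) 1‖ ≤ ‖x - p‖ := PiLp.norm_apply_le (x - p) 1
    have h2 := mem_ball_iff_norm.1 hx
    have h3 := le_abs_self ((x - p) 1)
    simp only [PiLp.sub_apply, Real.norm_eq_abs] at h1 h3
    simp only [LinearIsometryEquiv.coe_refl, id]
    linarith
  · obtain ⟨R, φ, U, hU, hpU, hφ, hiff⟩ := hb p (by rw [hΩ.frontier_eq]; exact ⟨hp, hpΩ⟩)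
    exact ⟨R, φ, U ∩ Metric.ball p 1, IsGraphChart.inter ⟨hU, hφ, hiff⟩ Metric.isOpen_ball,
      ⟨hpU, Metric.mem_ball_self one_pos⟩, Metric.isBounded_ball.subset inter_subset_right⟩

open scoped ContDiff Manifold in
/-- A finite `C¹` partition of unity on `closure Ω`, each member of which has compact support inside
one chart. -/
theorem exists_partition_of_charts (hΩ : IsOpen Ω) (hΩb : Bornology.IsBounded Ω)
    (hb : HasC1Boundary Ω) :
    ∃ (t : Finset Plane) (R : t → Plane ≃ₗᵢ[ℝ] Plane) (φ : t → ℝ → ℝ) (U : t → Set Plane)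
      (ρ : t → Plane → ℝ), (∀ i, IsGraphChart Ω (R i) (φ i) (U i)) ∧ (∀ i, ContDiff ℝ 1 (ρ i)) ∧
      (∀ i, IsCompact (tsupport (ρ i))) ∧ (∀ i, tsupport (ρ i) ⊆ U i) ∧
      ∀ x ∈ closure Ω, ∑ i, ρ i x = 1 := by
  choose! R φ U hchart hmem hbdd using fun p (hp : p ∈ closure Ω) => exists_isGraphChart hΩ hb hp
  obtain ⟨t, ht, hcover⟩ := hΩb.isCompact_closure.elim_nhds_subcover U
    fun p hp => (hchart p hp).isOpen.mem_nhds (hmem p hp)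
  obtain ⟨ρ, hρ⟩ := SmoothPartitionOfUnity.exists_isSubordinate 𝓘(ℝ, Plane) isClosed_closure
    (fun i : t => U i) (fun i => (hchart i (ht i i.2)).isOpen)
    (by rw [iUnion_subtype]; exact hcover)
  refine ⟨t, fun i => R i, fun i => φ i, fun i => U i, fun i => ρ i,
    fun i => hchart i (ht i i.2), fun i => ?_, fun i => ?_, hρ, fun x hx => ?_⟩
  · exact (ρ i).contMDiff.contDiff.of_le (by exact_mod_cast le_top)
  · exact Metric.isCompact_of_isClosed_isBounded (isClosed_tsupport _)
      ((hbdd i (ht i i.2)).subset (hρ i))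
  · rw [← finsum_eq_sum_of_fintype]
    exact ρ.sum_eq_one hx

theorem exists_norm_fderiv_mul_le (hΩ : IsOpen Ω) (hΩb : Bornology.IsBounded Ω) {ρ f : Plane → ℝ}
    (hρ : ContDiff ℝ 1 ρ) (hf : ContinuousOn f (closure Ω)) (hd : DifferentiableOn ℝ f Ω)
    {C : ℝ} (hC : ∀ x ∈ Ω, ‖fderiv ℝ f x‖ ≤ C) :
    ∃ B, ∀ x ∈ Ω, ‖fderiv ℝ (fun y => ρ y * f y) x‖ ≤ B := by
  obtain ⟨B₁, hB₁⟩ := hΩb.isCompact_closure.exists_bound_of_continuousOn hf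
  obtain ⟨B₂, hB₂⟩ := hΩb.isCompact_closure.exists_bound_of_continuousOn hρ.continuous.continuousOn
  obtain ⟨B₃, hB₃⟩ := hΩb.isCompact_closure.exists_bound_of_continuousOn
    (hρ.continuous_fderiv (by simp)).continuousOn
  refine ⟨B₂ * C + B₁ * B₃, fun x hx => ?_⟩
  have hx' := subset_closure hx
  rw [fderiv_fun_mul (hρ.differentiable (by simp) x) (hd.differentiableAt (hΩ.mem_nhds hx))]
  refine (norm_add_le _ _).trans ?_
  rw [norm_smul, norm_smul]
  have h1 := hB₁ x hx'
  have h2 := hB₂ x hx'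
  gcongr
  · exact (norm_nonneg _).trans h2
  · exact hC x hx
  · exact (norm_nonneg _).trans h1
  · exact hB₃ x hx'

theorem integrableOn_fderiv_apply (hΩ : IsOpen Ω) (hΩb : Bornology.IsBounded Ω) {f : Plane → ℝ}
    {C : ℝ} (hC : ∀ x ∈ Ω, ‖fderiv ℝ f x‖ ≤ C) (v : Plane) :
    IntegrableOn (fun x => fderiv ℝ f x v) Ω := by
  refine Measure.integrableOn_of_bounded (M := C * ‖v‖) hΩb.measure_lt_top.ne
    (measurable_fderiv_apply_const ℝ f v).aestronglyMeasurable ?_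
  exact ae_restrict_of_forall_mem hΩ.measurableSet fun x hx =>
    (fderiv ℝ f x).le_of_opNorm_le (hC x hx) v

/-- **Gradient theorem** on a bounded open set with `C¹` boundary, for a function that is continuous
on the closure and has a bounded derivative inside: the charts are glued by a partition of unity. -/
theorem setIntegral_fderiv_eq_boundary (hΩ : IsOpen Ω) (hΩb : Bornology.IsBounded Ω)
    (hb : HasC1Boundary Ω) {f : Plane → ℝ} (hf : ContinuousOn f (closure Ω))
    (hd : DifferentiableOn ℝ f Ω) {C : ℝ} (hC : ∀ x ∈ Ω, ‖fderiv ℝ f x‖ ≤ C) (v : Plane) :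
    IntegrableOn (fun x => f x * inner ℝ (outwardNormal Ω x) v) (frontier Ω)
      (Measure.hausdorffMeasure 1) ∧
    ∫ x in Ω, fderiv ℝ f x v
      = ∫ x in frontier Ω, f x * inner ℝ (outwardNormal Ω x) v ∂(Measure.hausdorffMeasure 1) := by
  obtain ⟨t, R, φ, U, ρ, hchart, hρ, hcpt, hsub, hsum⟩ := exists_partition_of_charts hΩ hΩb hb
  set F : t → Plane → ℝ := fun i x => ρ i x * f x
  have hF0 : ∀ i, ∀ x ∉ tsupport (ρ i), F i x = 0 := fun i x hx => by
    simp [F, image_eq_zero_of_notMem_tsupport hx]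
  have hFc : ∀ i, ContinuousOn (F i) (closure Ω) := fun i =>
    (hρ i).continuous.continuousOn.mul hf
  have hFd : ∀ i, DifferentiableOn ℝ (F i) Ω := fun i =>
    ((hρ i).differentiable (by simp)).differentiableOn.mul hd
  have hFC : ∀ i, ∃ B, ∀ x ∈ Ω, ‖fderiv ℝ (F i) x‖ ≤ B := fun i =>
    exists_norm_fderiv_mul_le hΩ hΩb (hρ i) hf hd hC
  choose B hB using hFC
  have hsumF : ∀ x ∈ closure Ω, f x = ∑ i, F i x := fun x hx => by
    rw [← Finset.sum_mul, hsum x hx, one_mul]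
  have hbd := fun i => (hchart i).boundary_integral hΩ hb (hcpt i) (hsub i) (hF0 i) (hFc i) v
  have hin := fun i => (hchart i).setIntegral_fderiv hΩ (hcpt i) (hsub i) (hF0 i) (hFc i) (hFd i)
    (hB i) v
  have hfr : EqOn (fun x => ∑ i, F i x * inner ℝ (outwardNormal Ω x) v)
      (fun x => f x * inner ℝ (outwardNormal Ω x) v) (frontier Ω) := fun x hx => by
    simp only
    rw [hsumF x (frontier_subset_closure hx), Finset.sum_mul]
  have hfd : EqOn (fun x => fderiv ℝ f x v) (fun x => ∑ i, fderiv ℝ (F i) x v) Ω := fun x hx => by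
    have h1 : f =ᶠ[𝓝 x] fun y => ∑ i, F i y := by
      filter_upwards [hΩ.mem_nhds hx] with y hy using hsumF y (subset_closure hy)
    simp only
    rw [h1.fderiv_eq, fderiv_fun_sum fun i _ => (hFd i).differentiableAt (hΩ.mem_nhds hx)]
    simp
  constructor
  · exact IntegrableOn.congr_fun (integrable_finsetSum _ fun i _ => (hbd i).1) hfr
      measurableSet_frontier
  · rw [setIntegral_congr_fun hΩ.measurableSet hfd,
      ← setIntegral_congr_fun measurableSet_frontier hfr,
      integral_finsetSum _ fun i _ => integrableOn_fderiv_apply hΩ hΩb (hB i) v,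
      integral_finsetSum _ fun i _ => (hbd i).1]
    exact Finset.sum_congr rfl fun i _ => (hin i).trans (hbd i).2.symm

/-- **Divergence theorem** on a bounded open set with `C¹` boundary. -/
theorem setIntegral_divergence_eq_boundary (hΩ : IsOpen Ω) (hΩb : Bornology.IsBounded Ω)
    (hb : HasC1Boundary Ω) {V : Plane → Plane}
    (hf : ∀ i, ContinuousOn (fun x => V x i) (closure Ω))
    (hd : ∀ i, DifferentiableOn ℝ (fun x => V x i) Ω)
    (hC : ∀ i, ∃ C, ∀ x ∈ Ω, ‖fderiv ℝ (fun y => V y i) x‖ ≤ C) :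
    IntegrableOn (fun x => inner ℝ (outwardNormal Ω x) (V x)) (frontier Ω)
      (Measure.hausdorffMeasure 1) ∧
    ∫ x in Ω, divergence V x
      = ∫ x in frontier Ω, inner ℝ (outwardNormal Ω x) (V x) ∂(Measure.hausdorffMeasure 1) := by
  choose C hC using hC
  have h := fun i => setIntegral_fderiv_eq_boundary hΩ hΩb hb (hf i) (hd i) (hC i)
    (EuclideanSpace.single i 1)
  have hsplit : ∀ x, inner ℝ (outwardNormal Ω x) (V x)
      = V x 0 * inner ℝ (outwardNormal Ω x) (EuclideanSpace.single (0 : Fin 2) (1 : ℝ))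
        + V x 1 * inner ℝ (outwardNormal Ω x) (EuclideanSpace.single (1 : Fin 2) (1 : ℝ)) := by
    intro x
    simp [PiLp.inner_apply, Fin.sum_univ_two]
  simp_rw [hsplit]
  refine ⟨(h 0).1.add (h 1).1, ?_⟩
  rw [integral_add (h 0).1 (h 1).1, ← (h 0).2, ← (h 1).2]
  exact integral_add (integrableOn_fderiv_apply hΩ hΩb (hC 0) _)
    (integrableOn_fderiv_apply hΩ hΩb (hC 1) _)

end Gradient

/-! ### Derivatives up to the boundary and differentiation under the integral -/

section Closure

variable {Ω : Set Plane}

/-- At a boundary point the tangent cone of `Ω` contains the open half plane of inward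
directions. -/
theorem uniqueDiffOn_closure (hΩ : IsOpen Ω) (hb : HasC1Boundary Ω) :
    UniqueDiffOn ℝ (closure Ω) := by
  intro p hp
  by_cases hpΩ : p ∈ Ω
  · exact uniqueDiffWithinAt_of_mem_nhds (mem_of_superset (hΩ.mem_nhds hpΩ) subset_closure)
  have hν := outwardNormal_spec hΩ hb (p := p) (by rw [hΩ.frontier_eq]; exact ⟨hp, hpΩ⟩)
  set ν := outwardNormal Ω p
  have hsub : {w : Plane | inner ℝ ν w < 0} ⊆ tangentConeAt ℝ (closure Ω) p := fun w hw => by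
    refine mem_tangentConeAt_of_add_smul_mem (l := 𝓝[>] (0 : ℝ)) (c := id) ?_ ?_
    · exact tendsto_id'.2 (nhdsWithin_mono _ fun s hs => ne_of_gt hs)
    · exact (hν.2.1 w hw).mono fun s hs => subset_closure hs
  have hopen : IsOpen {w : Plane | inner ℝ ν w < 0} :=
    isOpen_lt (by fun_prop) continuous_const
  have hmem : -ν ∈ {w : Plane | inner ℝ ν w < 0} := by
    simp [hν.1]
  have htop : Submodule.span ℝ (tangentConeAt ℝ (closure Ω) p) = ⊤ := by
    refine Submodule.eq_top_of_nonempty_interior' _ ⟨-ν, ?_⟩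
    exact mem_interior.2 ⟨_, hsub.trans Submodule.subset_span, hopen, hmem⟩
  refine (uniqueDiffWithinAt_iff ℝ _ _).2 ⟨?_, subset_closure hp⟩
  rw [htop]
  exact dense_univ

theorem exists_norm_fderiv_le (hΩ : IsOpen Ω) (hΩb : Bornology.IsBounded Ω)
    (hb : HasC1Boundary Ω) {f : Plane → ℝ} (hf : ContDiffOn ℝ 1 f (closure Ω)) :
    ∃ C, ∀ x ∈ Ω, ‖fderiv ℝ f x‖ ≤ C := by
  obtain ⟨C, hC⟩ := hΩb.isCompact_closure.exists_bound_of_continuousOn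
    (hf.continuousOn_fderivWithin (uniqueDiffOn_closure hΩ hb) le_rfl)
  refine ⟨C, fun x hx => ?_⟩
  rw [← fderivWithin_of_mem_nhds (mem_of_superset (hΩ.mem_nhds hx) subset_closure)]
  exact hC x (subset_closure hx)

theorem differentiableAt_of_contDiffOn_closure {F : Type*} [NormedAddCommGroup F]
    [NormedSpace ℝ F] {f : Plane → F} (hf : ContDiffOn ℝ 1 f (closure Ω)) (hΩ : IsOpen Ω)
    {x : Plane} (hx : x ∈ Ω) : DifferentiableAt ℝ f x :=
  (hf.differentiableOn (by simp)).differentiableAt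
    (mem_of_superset (hΩ.mem_nhds hx) subset_closure)

theorem IsTimeInterval.uniqueDiffOn {I : Set ℝ} (hI : IsTimeInterval I) : UniqueDiffOn ℝ I := by
  obtain ⟨a, ha, b, hb, hab⟩ := hI.2.2.exists_lt
  refine uniqueDiffOn_convex hI.1.convex ⟨(a + b) / 2, mem_interior.2 ⟨Ioo a b, ?_, isOpen_Ioo, ?_⟩⟩
  · exact Ioo_subset_Icc_self.trans (hI.1.out ha hb)
  · constructor <;> linarith

/-- Every time in `I` has a compact neighbourhood `[0, b]` relative to `I`. -/
theorem IsTimeInterval.exists_Icc_mem_nhdsWithin {I : Set ℝ} (hI : IsTimeInterval I) {t : ℝ}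
    (ht : t ∈ I) : ∃ b, t ≤ b ∧ Icc 0 b ⊆ I ∧ Icc 0 b ∈ 𝓝[I] t := by
  by_cases h : ∃ b ∈ I, t < b
  · obtain ⟨b, hb, htb⟩ := h
    refine ⟨b, htb.le, hI.1.out hI.2.1.1 hb, ?_⟩
    filter_upwards [self_mem_nhdsWithin, mem_nhdsWithin_of_mem_nhds (Iio_mem_nhds htb)] with s hs hsb
    exact ⟨hI.2.1.2 hs, le_of_lt hsb⟩
  · push Not at h
    refine ⟨t, le_rfl, hI.1.out hI.2.1.1 ht, ?_⟩
    filter_upwards [self_mem_nhdsWithin] with s hs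
    exact ⟨hI.2.1.2 hs, h s hs⟩

variable {I : Set ℝ}

/-- The time derivative of a function that is `C¹` up to the boundary; it is jointly continuous in time
and space, being a component of the full derivative. -/
theorem hasDerivWithinAt_time {F : Type*} [NormedAddCommGroup F] [NormedSpace ℝ F]
    {e : ℝ × Plane → F} (he : ContDiffOn ℝ 1 e (I ×ˢ closure Ω))
    {s : ℝ} (hs : s ∈ I) {x : Plane} (hx : x ∈ closure Ω) :
    HasDerivWithinAt (fun s => e (s, x))
      (fderivWithin ℝ e (I ×ˢ closure Ω) (s, x) (1, 0)) I s := by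
  have h1 : HasFDerivWithinAt e (fderivWithin ℝ e (I ×ˢ closure Ω) (s, x)) (I ×ˢ closure Ω) (s, x) :=
    (he.differentiableOn (by simp) (s, x) ⟨hs, hx⟩).hasFDerivWithinAt
  have h2 : HasDerivWithinAt (fun s : ℝ => (s, x)) (1, 0) I s :=
    (hasDerivWithinAt_id s I).prodMk (hasDerivWithinAt_const s I x)
  exact h1.comp_hasDerivWithinAt s h2
    (show MapsTo (fun s : ℝ => (s, x)) I (I ×ˢ closure Ω) from fun r hr => ⟨hr, hx⟩)

theorem contDiffOn_slice {F : Type*} [NormedAddCommGroup F] [NormedSpace ℝ F]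
    {e : ℝ × Plane → F} (he : ContDiffOn ℝ 1 e (I ×ˢ closure Ω))
    {s : ℝ} (hs : s ∈ I) : ContDiffOn ℝ 1 (fun x => e (s, x)) (closure Ω) :=
  he.comp (contDiff_prodMk_right s).contDiffOn fun _ hx => ⟨hs, hx⟩

theorem integrableOn_of_continuousOn_closure (hΩb : Bornology.IsBounded Ω) {f : Plane → ℝ}
    (hf : ContinuousOn f (closure Ω)) : IntegrableOn f Ω :=
  (hf.integrableOn_compact hΩb.isCompact_closure).mono_set subset_closure

/-- Differentiation under the integral sign over a bounded domain, one-sided at the end points of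
the time interval. -/
theorem hasDerivWithinAt_setIntegral (hΩ : IsOpen Ω) (hΩb : Bornology.IsBounded Ω)
    (hb : HasC1Boundary Ω) (hI : IsTimeInterval I)
    {e : ℝ × Plane → ℝ} (he : ContDiffOn ℝ 1 e (I ×ˢ closure Ω)) {t : ℝ} (ht : t ∈ I) :
    HasDerivWithinAt (fun s => ∫ x in Ω, e (s, x))
      (∫ x in Ω, derivWithin (fun s => e (s, x)) I t) I t := by
  obtain ⟨b, htb, hJI, hJ⟩ := hI.exists_Icc_mem_nhdsWithin ht
  have htJ : t ∈ Icc 0 b := ⟨hI.2.1.2 ht, htb⟩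
  have hU : UniqueDiffOn ℝ (I ×ˢ closure Ω) := hI.uniqueDiffOn.prod (uniqueDiffOn_closure hΩ hb)
  obtain ⟨C, hC⟩ := (isCompact_Icc.prod hΩb.isCompact_closure).exists_bound_of_continuousOn
    ((he.continuousOn_fderivWithin hU le_rfl).mono (prod_mono_left hJI))
  -- The mean value theorem in time bounds the difference quotients.
  have hslope : ∀ s ∈ Icc 0 b, ∀ x ∈ Ω, ‖slope (fun s => e (s, x)) t s‖ ≤ C := by
    intro s hs x hx
    have hx' := subset_closure hx
    have hC0 : 0 ≤ C := (norm_nonneg _).trans (hC (t, x) ⟨htJ, hx'⟩)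
    have h1 := (convex_Icc (0 : ℝ) b).norm_image_sub_le_of_norm_hasDerivWithin_le (C := C)
      (fun r hr => (hasDerivWithinAt_time he (hJI hr) hx').mono hJI)
      (fun r hr => by
        have := (fderivWithin ℝ e (I ×ˢ closure Ω) (r, x)).le_of_opNorm_le
          (hC (r, x) ⟨hr, hx'⟩) (1, 0)
        simpa using this) htJ hs
    rw [slope_def_module, norm_smul, norm_inv]
    exact inv_mul_le_of_le_mul₀ (norm_nonneg _) hC0 (by rwa [mul_comm])
  rw [hasDerivWithinAt_iff_tendsto_slope]
  have hJ' : ∀ᶠ s in 𝓝[I \ {t}] t, s ∈ Icc 0 b := nhdsWithin_mono _ sdiff_subset hJ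
  have hint : ∀ s ∈ I, IntegrableOn (fun x => e (s, x)) Ω := fun s hs =>
    integrableOn_of_continuousOn_closure hΩb (contDiffOn_slice he hs).continuousOn
  have heq : ∀ᶠ s in 𝓝[I \ {t}] t, ∫ x in Ω, slope (fun s => e (s, x)) t s
      = slope (fun s => ∫ x in Ω, e (s, x)) t s := by
    filter_upwards [hJ'] with s hs
    simp only [slope_def_module]
    rw [integral_smul, integral_sub (hint s (hJI hs)) (hint t ht)]
  refine Tendsto.congr' heq (tendsto_integral_filter_of_dominated_convergence (fun _ => C)
    ?_ ?_ (integrableOn_const hΩb.measure_lt_top.ne) ?_)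
  · filter_upwards [hJ'] with s hs
    simp only [slope_def_module]
    exact (((hint s (hJI hs)).sub (hint t ht)).smul ((s - t)⁻¹)).aestronglyMeasurable
  · filter_upwards [hJ'] with s hs
    exact ae_restrict_of_forall_mem hΩ.measurableSet fun x hx => hslope s hs x hx
  · refine ae_restrict_of_forall_mem hΩ.measurableSet fun x hx => ?_
    exact hasDerivWithinAt_iff_tendsto_slope.1
      (hasDerivWithinAt_time he ht (subset_closure hx)).differentiableWithinAt.hasDerivWithinAt

end Closure

/-! ### Energy balance -/

section Energy

variable {g fc : ℝ} {Ω : Set Plane} {I : Set ℝ} {h : ℝ → Plane → ℝ} {u : ℝ → Plane → Plane}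

theorem IsClassicalSolution.contDiffOn_elementalEnergy (hsol : IsClassicalSolution g fc Ω I h u) :
    ContDiffOn ℝ 1 (fun q : ℝ × Plane => elementalEnergy g (h q.1) (u q.1) q.2)
      (I ×ˢ closure Ω) :=
  ((contDiffOn_const.mul hsol.contDiffOn_h).mul (hsol.contDiffOn_u.norm_sq ℝ)).add
    (contDiffOn_const.mul (hsol.contDiffOn_h.pow 2))

variable {t : ℝ}

theorem IsClassicalSolution.contDiffOn_bernoulliPotential
    (hsol : IsClassicalSolution g fc Ω I h u) (ht : t ∈ I) :
    ContDiffOn ℝ 1 (bernoulliPotential g (h t) (u t)) (closure Ω) :=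
  (contDiffOn_const.mul ((contDiffOn_slice hsol.contDiffOn_u ht).norm_sq ℝ)).add
    (contDiffOn_const.mul (contDiffOn_slice hsol.contDiffOn_h ht))

theorem IsClassicalSolution.contDiffOn_massFlux
    (hsol : IsClassicalSolution g fc Ω I h u) (ht : t ∈ I) :
    ContDiffOn ℝ 1 (massFlux (h t) (u t)) (closure Ω) :=
  (contDiffOn_slice hsol.contDiffOn_h ht).smul (contDiffOn_slice hsol.contDiffOn_u ht)

theorem inner_perp_self (w : Plane) : inner ℝ w (perp w) = 0 := by
  simp [perp, PiLp.inner_apply, Fin.sum_univ_two]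
  ring

theorem inner_gradient_eq (f : Plane → ℝ) (x w : Plane) :
    inner ℝ w (gradient f x) = w 0 * partialDeriv 0 f x + w 1 * partialDeriv 1 f x := by
  have hw : w = w 0 • EuclideanSpace.single (0 : Fin 2) (1 : ℝ)
      + w 1 • EuclideanSpace.single (1 : Fin 2) (1 : ℝ) := by
    ext i
    fin_cases i <;> simp
  rw [real_inner_comm, gradient, InnerProductSpace.toDual_symm_apply]
  conv_lhs => rw [hw]
  rw [map_add, map_smul, map_smul]
  rfl

theorem divergence_smul {G : Plane → ℝ} {F : Plane → Plane} {x : Plane}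
    (hG : DifferentiableAt ℝ G x) (hF : DifferentiableAt ℝ F x) :
    divergence (fun y => G y • F y) x = G x * divergence F x
      + (F x 0 * partialDeriv 0 G x + F x 1 * partialDeriv 1 G x) := by
  have h1 : ∀ i : Fin 2, partialDeriv i (fun y => (G y • F y) i) x
      = G x * partialDeriv i (fun y => F y i) x + F x i * partialDeriv i G x := by
    intro i
    have hFi : DifferentiableAt ℝ (fun y => F y i) x := by fun_prop
    simp only [partialDeriv, PiLp.smul_apply, smul_eq_mul]
    rw [fderiv_fun_mul hG hFi]
    simp
  simp only [divergence, h1]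
  ring

/-- The local energy balance `∂ₜ e = -∇ · (G F)`; the vorticity term does no work, because `u^⊥` is
orthogonal to `u`. -/
theorem IsClassicalSolution.derivWithin_elementalEnergy (hΩ : IsOpen Ω) (hI : IsTimeInterval I)
    (hsol : IsClassicalSolution g fc Ω I h u) (ht : t ∈ I) {x : Plane} (hx : x ∈ Ω) :
    derivWithin (fun s => elementalEnergy g (h s) (u s) x) I t
      = -divergence (fun y => bernoulliPotential g (h t) (u t) y • massFlux (h t) (u t) y) x := by
  have hx' := subset_closure hx
  have hh : HasDerivWithinAt (fun s => h s x) (derivWithin (fun s => h s x) I t) I t :=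
    (hasDerivWithinAt_time hsol.contDiffOn_h ht hx').differentiableWithinAt.hasDerivWithinAt
  have hu : HasDerivWithinAt (fun s => u s x) (derivWithin (fun s => u s x) I t) I t :=
    (hasDerivWithinAt_time hsol.contDiffOn_u ht hx').differentiableWithinAt.hasDerivWithinAt
  have he := ((hh.const_mul (1 / 2)).mul hu.norm_sq).add ((hh.pow 2).const_mul (1 / 2 * g))
  have hd := he.derivWithin (hI.uniqueDiffOn t ht)
  have hmass := hsol.mass t ht x hx
  have hmom := congrArg (inner ℝ (u t x)) (hsol.momentum t ht x hx)
  rw [inner_add_right, inner_add_right, inner_smul_right, inner_perp_self, inner_gradient_eq,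
    inner_zero_right] at hmom
  rw [divergence_smul (differentiableAt_of_contDiffOn_closure (hsol.contDiffOn_bernoulliPotential ht) hΩ hx)
    (differentiableAt_of_contDiffOn_closure (hsol.contDiffOn_massFlux ht) hΩ hx)]
  refine hd.trans ?_
  simp only [massFlux, bernoulliPotential, PiLp.smul_apply, smul_eq_mul] at hmom hmass ⊢
  -- `∂ₜ e = G ∂ₜ h + F · ∂ₜ u`.
  linear_combination (1 / 2 * ‖u t x‖ ^ 2 + g * h t x) * hmass + h t x * hmom

theorem inner_outwardNormal_smul_massFlux (k : ℝ) (a : Plane → ℝ) (w : Plane → Plane) (x : Plane) :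
    inner ℝ (outwardNormal Ω x) (k • massFlux a w x) = k * normalFlux Ω a w x := by
  simp [massFlux, normalFlux, normalVelocity, PiLp.inner_apply, Fin.sum_univ_two]
  ring

/-- Integrated energy balance: `dE/dt` is the boundary term. -/
theorem IsClassicalSolution.hasDerivWithinAt_energy (hΩ : IsOpen Ω)
    (hΩb : Bornology.IsBounded Ω) (hb : HasC1Boundary Ω) (hI : IsTimeInterval I)
    (hsol : IsClassicalSolution g fc Ω I h u) (ht : t ∈ I) :
    IntegrableOn (fun x => bernoulliPotential g (h t) (u t) x * normalFlux Ω (h t) (u t) x)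
        (frontier Ω) (Measure.hausdorffMeasure 1) ∧
      HasDerivWithinAt (fun s => energy g Ω (h s) (u s)) (boundaryTerm g Ω (h t) (u t)) I t := by
  have hV : ContDiffOn ℝ 1
      (fun x => bernoulliPotential g (h t) (u t) x • massFlux (h t) (u t) x) (closure Ω) :=
    (hsol.contDiffOn_bernoulliPotential ht).smul (hsol.contDiffOn_massFlux ht)
  have hVi : ∀ i, ContDiffOn ℝ 1
      (fun x => (bernoulliPotential g (h t) (u t) x • massFlux (h t) (u t) x) i) (closure Ω) :=
    contDiffOn_euclidean.1 hV
  have hdiv := setIntegral_divergence_eq_boundary hΩ hΩb hb (fun i => (hVi i).continuousOn)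
    (fun i x hx => (differentiableAt_of_contDiffOn_closure (hVi i) hΩ hx).differentiableWithinAt)
    (fun i => exists_norm_fderiv_le hΩ hΩb hb (hVi i))
  simp_rw [inner_outwardNormal_smul_massFlux] at hdiv
  refine ⟨hdiv.1, ?_⟩
  have hE := hasDerivWithinAt_setIntegral hΩ hΩb hb hI hsol.contDiffOn_elementalEnergy ht
  rw [setIntegral_congr_fun hΩ.measurableSet
    (fun x hx => hsol.derivWithin_elementalEnergy hΩ hI ht hx), integral_neg, hdiv.2] at hE
  exact hE

/-- With homogeneous data there is no inflow: where `u_n < 0`, the identity `α G_n = β F_n` equates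
a nonnegative and a nonpositive number, so that both weights would vanish. -/
theorem normalVelocity_nonneg (hg : 0 < g) {a : Plane → ℝ} {w : Plane → Plane} {x : Plane}
    (ha : 0 < a x) {α β : ℝ} (hα : 0 ≤ α) (hβ : 0 ≤ β) (hαβ : 0 < |α| ^ 2 + |β| ^ 2)
    (hbc : α * normalBernoulli g Ω a w x - β * normalFlux Ω a w x = 0) :
    0 ≤ normalVelocity Ω w x := by
  by_contra! hneg
  have hG : 0 < normalBernoulli g Ω a w x := by
    unfold normalBernoulli
    positivity
  have hF : normalFlux Ω a w x < 0 := mul_neg_of_pos_of_neg ha hneg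
  have h1 : 0 ≤ α * normalBernoulli g Ω a w x := mul_nonneg hα hG.le
  have h2 : β * normalFlux Ω a w x ≤ 0 := mul_nonpos_of_nonneg_of_nonpos hβ hF.le
  have h3 : α = 0 := (mul_eq_zero.1 (by linarith : α * normalBernoulli g Ω a w x = 0)).resolve_right
    hG.ne'
  have h4 : β = 0 := (mul_eq_zero.1 (by linarith : β * normalFlux Ω a w x = 0)).resolve_right hF.ne
  simp [h3, h4] at hαβ

theorem bernoulliPotential_mul_normalFlux_nonneg (hg : 0 < g) {a : Plane → ℝ} {w : Plane → Plane}
    {x : Plane} (ha : 0 < a x) (hn : 0 ≤ normalVelocity Ω w x) :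
    0 ≤ bernoulliPotential g a w x * normalFlux Ω a w x := by
  unfold bernoulliPotential normalFlux
  positivity

end Energy

end RSWE

theorem mainTheorem3
    (g fc : ℝ) (hg : 0 < g)
    (Ω : Set RSWE.Plane) (hΩ : IsOpen Ω) (hΩ_bdd : Bornology.IsBounded Ω)
    (hΩ_C1 : RSWE.HasC1Boundary Ω)
    (I : Set ℝ) (hI : RSWE.IsTimeInterval I)
    (h₀ : RSWE.Plane → ℝ) (u₀ : RSWE.Plane → RSWE.Plane)
    (h : ℝ → RSWE.Plane → ℝ) (u : ℝ → RSWE.Plane → RSWE.Plane)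
    (hsol : RSWE.IsClassicalSolution g fc Ω I h u)
    (hsub : RSWE.IsSubcritical g Ω I h u)
    (hinit : RSWE.SatisfiesInitialCondition Ω h₀ u₀ h u)
    (α β : ℝ → RSWE.Plane → ℝ)
    (hα : ∀ t ∈ I, ∀ x ∈ frontier Ω, 0 ≤ α t x)
    (hβ : ∀ t ∈ I, ∀ x ∈ frontier Ω, 0 ≤ β t x)
    (hαβ : ∀ t ∈ I, ∀ x ∈ frontier Ω, 0 < |α t x| ^ 2 + |β t x| ^ 2)
    (hbc : RSWE.SatisfiesBoundaryCondition g Ω I α β h u) :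
    (∀ t ∈ I,
      IntegrableOn (RSWE.elementalEnergy g (h t) (u t)) Ω ∧
      IntegrableOn (fun x => RSWE.bernoulliPotential g (h t) (u t) x * RSWE.normalFlux Ω (h t) (u t) x)
        (frontier Ω) (Measure.hausdorffMeasure 1) ∧
      HasDerivWithinAt (fun s => RSWE.energy g Ω (h s) (u s))
        (RSWE.boundaryTerm g Ω (h t) (u t)) I t ∧
      RSWE.boundaryTerm g Ω (h t) (u t) ≤ 0) ∧
    ∀ t ∈ I, RSWE.energy g Ω (h t) (u t) ≤ RSWE.energy g Ω h₀ u₀ := by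
  have hbal := fun t ht => hsol.hasDerivWithinAt_energy hΩ hΩ_bdd hΩ_C1 hI (t := t) ht
  have hBT : ∀ t ∈ I, RSWE.boundaryTerm g Ω (h t) (u t) ≤ 0 := by
    intro t ht
    refine neg_nonpos.2 (setIntegral_nonneg measurableSet_frontier fun x hx => ?_)
    have hpos := hsol.height_pos t ht x (frontier_subset_closure hx)
    exact RSWE.bernoulliPotential_mul_normalFlux_nonneg hg hpos (RSWE.normalVelocity_nonneg hg hpos
      (hα t ht x hx) (hβ t ht x hx) (hαβ t ht x hx) (hbc t ht x hx).1)
  refine ⟨fun t ht => ⟨?_, (hbal t ht).1, (hbal t ht).2, hBT t ht⟩, fun t ht => ?_⟩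
  · exact RSWE.integrableOn_of_continuousOn_closure hΩ_bdd
      (RSWE.contDiffOn_slice hsol.contDiffOn_elementalEnergy ht).continuousOn
  · have hanti : AntitoneOn (fun s => RSWE.energy g Ω (h s) (u s)) I :=
      antitoneOn_of_hasDerivWithinAt_nonpos hI.1.convex
        (fun s hs => (hbal s hs).2.continuousWithinAt)
        (fun s hs => (hbal s (interior_subset hs)).2.mono interior_subset)
        fun s hs => hBT s (interior_subset hs)
    have h0 : RSWE.energy g Ω (h 0) (u 0) = RSWE.energy g Ω h₀ u₀ := by
      refine setIntegral_congr_fun hΩ.measurableSet fun x hx => ?_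
      simp only [RSWE.elementalEnergy, (hinit x hx).1, (hinit x hx).2]
    rw [← h0]
    exact hanti hI.2.1.1 ht (hI.2.1.2 ht)
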